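/- Let $\gamma$ be the standard Gaussian measure on $\mathbb{R}$ and $\mu=\bigotimes_{n\in\mathbb{N}}\gamma$ the product probability measure on $\mathbb{R}^{\mathbb{N}}$. Let $\mathbb{R}^{\infty}=\{(x_n)\in\mathbb{R}^{\mathbb{N}} : x_n=0 \text{ eventually}\}$ carry the inductive limit topology of $\mathbb{R}^n\hookrightarrow\mathbb{R}^{n+1}$, $v\mapsto(v,0)$, let $\mathbb{R}_+^{\infty}=\{x\in\mathbb{R}^\infty : x_n\ge 0 \text{ for all } n\}$ with the subspace topology, and let $e_i$ be the $i$-th standard basis vector. For $x\in\mathbb{R}^{\infty}$ let $T_x(y)=x+y$ on $\mathbb{R}^{\mathbb{N}}$ and let $U_x$ be the Koopman operator on the complex Hilbert space $L^2(\mathbb{R}^{\mathbb{N}},\mu)$ given by \[U_xf=\sqrt{\frac{d(\mu\circ T_x^{-1})}{d\mu}}\; f\circ T_x^{-1}.\] Let $X$ be the set of sequences $a=(a_n)_{n\in\mathbb{N}}$ of real numbers with $a_n\le 0$ for all $n$ and $\prod_{n}\gamma([a_n,\infty))>0$. Let $a\in X$ and $A=\prod_{n}[a_n,\infty)\subset\mathbb{R}^{\mathbb{N}}$.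 Regard $L^2(A)$ as the closed subspace of $L^2(\mathbb{R}^{\mathbb{N}},\mu)$ of functions vanishing almost everywhere outside $A$; it is invariant under $U_x$ for $x\in\mathbb{R}_+^{\infty}$, and $V^A_x$ denotes the restriction of $U_x$ to $L^2(A)$. Then $L^2(A)$ is a separable Hilbert space, and $V^A=\{V^A_x\}_{x\in\mathbb{R}_+^{\infty}}$ is an irreducible, strongly pure, doubly commuting isometric representation of $\mathbb{R}_+^{\infty}$ on $L^2(A)$, that is: 1. (isometric representation) $V^A_0=1$, $V^A_{x+y}=V^A_xV^A_y$ for all $x,y\in\mathbb{R}_+^\infty$, each $V^A_x$ is an isometry, and $x\mapsto V^A_x\xi$ is continuous for every $\xi\in L^2(A)$; 2. (doubly commuting) $V_{te_i}^{A*}V^A_{se_j}=V^A_{se_j}V_{te_i}^{A*}$ for all $s,t\ge 0$ and $i\ne j$; 3. (strongly pure) for every $i$, $V_{te_i}^{A*}\to 0$ in the strong operator topology as $t\to\infty$; 4. (irreducible) $L^2(A)\neq 0$ and the commutant $\{V^A_x,V_x^{A*} : x\in\mathbb{R}_+^{\infty}\}'$ in $B(L^2(A))$ consists of the scalar multiples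 of the identity. -/

import Mathlib

open MeasureTheory ProbabilityTheory Filter Topology
open scoped NNReal ENNReal

noncomputable section

/-! ### The semigroup of finitely supported non-negative sequences -/

/-- The inclusion of `ℝⁿ` into the space `ℝ^∞` of finitely supported real sequences,
`(v₀, …, vₙ₋₁) ↦ (v₀, …, vₙ₋₁, 0, 0, …)`. -/
def inclRInf (n : ℕ) (v : Fin n → ℝ) : ℕ →₀ ℝ :=
  ∑ i : Fin n, Finsupp.single (i : ℕ) (v i)

/-- The inductive limit topology on `ℝ^∞ = lim ℝⁿ`: the finest topology for which all the
inclusions of `ℝⁿ` are continuous. -/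
instance instTopologicalSpaceRInf : TopologicalSpace (ℕ →₀ ℝ) :=
  ⨆ n : ℕ, TopologicalSpace.coinduced (inclRInf n) inferInstance

/-- The additive semigroup `ℝ₊^∞` of finitely supported sequences of non-negative reals,
with the subspace topology of `ℝ^∞`. -/
abbrev RPlusInf : Type := {x : ℕ →₀ ℝ // 0 ≤ x}

/-- The element `t eᵢ` of `ℝ₊^∞`, for `t ≥ 0`. -/
def RPlusInf.ray (i : ℕ) (t : ℝ≥0) : RPlusInf :=
  ⟨Finsupp.single i (t : ℝ), Finsupp.single_nonneg.mpr t.2⟩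

/-! ### Isometric representations of `ℝ₊^∞` on a Hilbert space -/

section Representations

variable {H : Type*} [NormedAddCommGroup H] [InnerProductSpace ℂ H]

/-- A strongly continuous semigroup of isometries indexed by `ℝ₊^∞`. -/
structure IsIsometricRep (V : RPlusInf → (H →L[ℂ] H)) : Prop where
  map_zero : V 0 = 1
  map_add : ∀ x y, V (x + y) = V x * V y
  isometry : ∀ x, Isometry (V x)
  strongly_continuous : ∀ ξ : H, Continuous fun x => V x ξ

/-- `V_{t eᵢ}^* V_{s eⱼ} = V_{s eⱼ} V_{t eᵢ}^*` for all `s, t ≥ 0` and all `i ≠ j`. -/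
def IsDoublyCommuting [CompleteSpace H] (V : RPlusInf → (H →L[ℂ] H)) : Prop :=
  ∀ (i j : ℕ), i ≠ j → ∀ s t : ℝ≥0,
    ContinuousLinearMap.adjoint (V (RPlusInf.ray i t)) * V (RPlusInf.ray j s) =
      V (RPlusInf.ray j s) * ContinuousLinearMap.adjoint (V (RPlusInf.ray i t))

/-- For every `i`, `V_{t eᵢ}^* → 0` in the strong operator topology as `t → ∞`. -/
def IsStronglyPure [CompleteSpace H] (V : RPlusInf → (H →L[ℂ] H)) : Prop :=
  ∀ (i : ℕ) (ξ : H),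
    Tendsto (fun t : ℝ≥0 => ContinuousLinearMap.adjoint (V (RPlusInf.ray i t)) ξ) atTop (𝓝 0)

/-- The space is non-zero and the commutant `{V_x, V_x^* : x}'` consists of the scalars. -/
def IsIrreducibleRep [CompleteSpace H] (V : RPlusInf → (H →L[ℂ] H)) : Prop :=
  Nontrivial H ∧
    Set.centralizer
        (Set.range V ∪ Set.range fun x => ContinuousLinearMap.adjoint (V x)) =
      Set.range fun c : ℂ => c • (1 : H →L[ℂ] H)

end Representations

/-! ### Koopman operators -/

section Koopman

variable {α : Type*} [MeasurableSpace α] {μ : Measure α}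

/-- The function `√(d(μ ∘ T⁻¹)/dμ) · (f ∘ T⁻¹)`. -/
def koopmanFun (μ : Measure α) (T : α ≃ᵐ α) (f : α → ℂ) (y : α) : ℂ :=
  (√((μ.map T).rnDeriv μ y).toReal : ℂ) * f (T.symm y)

theorem koopmanFun_congr [IsFiniteMeasure μ] (T : α ≃ᵐ α) (h : μ.map T ≪ μ)
    {f g : α → ℂ} (hfg : f =ᵐ[μ] g) : koopmanFun μ T f =ᵐ[μ] koopmanFun μ T g := by
  have h1 : ∀ᵐ y ∂(μ.map T), f (T.symm y) = g (T.symm y) := by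
    rw [T.measurableEmbedding.ae_map_iff]
    simp only [MeasurableEquiv.symm_apply_apply]
    exact hfg
  rw [← Measure.withDensity_rnDeriv_eq _ _ h,
    ae_withDensity_iff (Measure.measurable_rnDeriv _ _)] at h1
  filter_upwards [h1] with y hy
  unfold koopmanFun
  by_cases h0 : (μ.map T).rnDeriv μ y = 0
  · simp [h0]
  · rw [hy h0]

theorem eLpNorm_koopmanFun [IsFiniteMeasure μ] (T : α ≃ᵐ α) (h : μ.map T ≪ μ)
    (f : α → ℂ) : eLpNorm (koopmanFun μ T f) 2 μ = eLpNorm f 2 μ := by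
  rw [eLpNorm_eq_lintegral_rpow_enorm_toReal (by norm_num) (by norm_num),
    eLpNorm_eq_lintegral_rpow_enorm_toReal (by norm_num) (by norm_num)]
  congr 1
  have h2 : ∀ z : ℂ, ‖z‖ₑ ^ ((2 : ℝ≥0∞).toReal) = ‖z‖ₑ ^ 2 := fun z => by simp
  simp only [h2]
  have h3 : ∫⁻ a, ‖f a‖ₑ ^ 2 ∂μ = ∫⁻ y, ‖f (T.symm y)‖ₑ ^ 2 ∂(μ.map T) := by
    rw [lintegral_map_equiv]; simp
  have hfin : ∀ᵐ y ∂μ, (μ.map T).rnDeriv μ y < ∞ := Measure.rnDeriv_lt_top _ _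
  rw [h3]
  conv_rhs => rw [← Measure.withDensity_rnDeriv_eq _ _ h]
  rw [lintegral_withDensity_eq_lintegral_mul_non_measurable _
    (Measure.measurable_rnDeriv _ _) hfin]
  refine lintegral_congr_ae ?_
  filter_upwards [hfin] with y hy
  simp only [koopmanFun, enorm_mul, mul_pow, Pi.mul_apply]
  congr 1
  rw [← ofReal_norm, Complex.norm_real, Real.norm_of_nonneg (Real.sqrt_nonneg _),
    ← ENNReal.ofReal_pow (Real.sqrt_nonneg _), Real.sq_sqrt ENNReal.toReal_nonneg,
    ENNReal.ofReal_toReal hy.ne]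

theorem memLp_koopmanFun [IsFiniteMeasure μ] (T : α ≃ᵐ α) (h : μ.map T ≪ μ)
    (f : Lp ℂ 2 μ) : MemLp (koopmanFun μ T f) 2 μ := by
  refine ⟨?_, by rw [eLpNorm_koopmanFun T h]; exact Lp.eLpNorm_lt_top f⟩
  refine AEStronglyMeasurable.mul ?_ ?_
  · exact (Complex.measurable_ofReal.comp
      (Measure.measurable_rnDeriv _ _).ennreal_toReal.sqrt).aestronglyMeasurable
  · exact ((Lp.stronglyMeasurable f).comp_measurable T.symm.measurable).aestronglyMeasurable

/-- The Koopman operator `f ↦ √(d(μ ∘ T⁻¹)/dμ) · (f ∘ T⁻¹)` on `L²(μ)`, for a bimeasurable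
bijection `T` with `μ ∘ T⁻¹ ≪ μ`. -/
def koopman [IsFiniteMeasure μ] (T : α ≃ᵐ α) (h : μ.map T ≪ μ) :
    Lp ℂ 2 μ →ₗᵢ[ℂ] Lp ℂ 2 μ where
  toFun f := (memLp_koopmanFun T h f).toLp _
  map_add' f g := by
    refine Lp.ext ?_
    filter_upwards [(memLp_koopmanFun T h (f + g)).coeFn_toLp,
      (memLp_koopmanFun T h f).coeFn_toLp, (memLp_koopmanFun T h g).coeFn_toLp,
      Lp.coeFn_add ((memLp_koopmanFun T h f).toLp _) ((memLp_koopmanFun T h g).toLp _),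
      koopmanFun_congr T h (Lp.coeFn_add f g)] with y h1 h2 h3 h4 h5
    rw [h1, h4, Pi.add_apply, h2, h3, h5]
    simp [koopmanFun, mul_add]
  map_smul' c f := by
    refine Lp.ext ?_
    filter_upwards [(memLp_koopmanFun T h (c • f)).coeFn_toLp,
      (memLp_koopmanFun T h f).coeFn_toLp,
      Lp.coeFn_smul c ((memLp_koopmanFun T h f).toLp _),
      koopmanFun_congr T h (Lp.coeFn_smul c f)] with y h1 h2 h4 h5
    rw [h1, RingHom.id_apply, h4, Pi.smul_apply, h2, h5]
    simp only [koopmanFun, Pi.smul_apply, smul_eq_mul]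
    ring
  norm_map' f := by
    change ‖(memLp_koopmanFun T h f).toLp _‖ = ‖f‖
    rw [Lp.norm_toLp, eLpNorm_koopmanFun T h, Lp.norm_def]

theorem coeFn_koopman [IsFiniteMeasure μ] (T : α ≃ᵐ α) (h : μ.map T ≪ μ) (f : Lp ℂ 2 μ) :
    koopman T h f =ᵐ[μ] koopmanFun μ T f :=
  (memLp_koopmanFun T h f).coeFn_toLp

end Koopman

/-! ### The infinite product Gaussian measure and its seqTranslates -/

/-- The infinite product of standard Gaussian measures on `ℝ^ℕ`. -/
def gaussianProd : Measure (ℕ → ℝ) := Measure.infinitePi fun _ => gaussianReal 0 1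

instance instIsProbabilityMeasureGaussianProd : IsProbabilityMeasure gaussianProd := by
  unfold gaussianProd; infer_instance

/-- The translation `T_x(y) = x + y` of `ℝ^ℕ`. -/
def seqTranslate (x : ℕ → ℝ) : (ℕ → ℝ) ≃ᵐ (ℕ → ℝ) := MeasurableEquiv.addLeft x

theorem map_seqTranslate_gaussianProd (x : ℕ → ℝ) :
    gaussianProd.map (seqTranslate x) = Measure.infinitePi fun i => gaussianReal (x i) 1 := by
  have h := Measure.infinitePi_map_pi (fun _ : ℕ => gaussianReal 0 1)
    (f := fun i z => x i + z) (fun i => measurable_const_add (x i))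
  have h1 : ∀ i, (gaussianReal 0 1).map (fun z => x i + z) = gaussianReal (x i) 1 := fun i => by
    rw [gaussianReal_map_const_add, zero_add]
  simp only [h1] at h
  exact h

theorem gaussianReal_absolutelyContinuous_zero (m : ℝ) :
    gaussianReal m 1 ≪ gaussianReal 0 1 :=
  (gaussianReal_absolutelyContinuous m one_ne_zero).trans
    (gaussianReal_absolutelyContinuous' 0 one_ne_zero)

theorem map_seqTranslate_absolutelyContinuous (x : ℕ →₀ ℝ) :
    gaussianProd.map (seqTranslate x) ≪ gaussianProd := by
  classical
  let ρ : ℕ → ℝ → ℝ≥0∞ := fun i => (gaussianReal (x i) 1).rnDeriv (gaussianReal 0 1)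
  have hρ : ∀ i, Measurable (ρ i) := fun i => Measure.measurable_rnDeriv _ _
  suffices h : gaussianProd.withDensity (fun y => ∏ i ∈ x.support, ρ i (y i)) =
      Measure.infinitePi fun i => gaussianReal (x i) 1 by
    rw [map_seqTranslate_gaussianProd, ← h]
    exact withDensity_absolutelyContinuous _ _
  refine Measure.eq_infinitePi _ fun s t ht => ?_
  let t' : ℕ → Set ℝ := fun i => if i ∈ s then t i else Set.univ
  have ht' : ∀ i, MeasurableSet (t' i) := fun i => by
    by_cases hi : i ∈ s <;> simp [t', hi, ht i]
  let h : ℕ → ℝ → ℝ≥0∞ := fun i => (t' i).indicator (if i ∈ x.support then ρ i else 1)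
  have hh : ∀ i, Measurable (h i) := fun i => by
    refine Measurable.indicator ?_ (ht' i)
    split_ifs
    · exact hρ i
    · exact measurable_const
  have hint : ∀ i, ∫⁻ z, h i z ∂(gaussianReal 0 1) = gaussianReal (x i) 1 (t' i) := by
    intro i
    rw [lintegral_indicator (ht' i)]
    by_cases hi : i ∈ x.support
    · simp only [hi, if_true]
      exact Measure.setLIntegral_rnDeriv (gaussianReal_absolutelyContinuous_zero _) _
    · have hx : x i = 0 := by simpa using hi
      simp [hx]
  have hpi : MeasurableSet ((s : Set ℕ).pi t) :=
    MeasurableSet.pi s.countable_toSet fun i _ => ht i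
  rw [withDensity_apply _ hpi, ← lintegral_indicator hpi]
  have hprod : ∀ y : ℕ → ℝ,
      ((s : Set ℕ).pi t).indicator (fun y => ∏ i ∈ x.support, ρ i (y i)) y =
        ∏ i ∈ s ∪ x.support, h i (y i) := by
    intro y
    by_cases hy : y ∈ (s : Set ℕ).pi t
    · rw [Set.indicator_of_mem hy]
      have hy' : ∀ i, y i ∈ t' i := fun i => by
        by_cases hi : i ∈ s
        · simpa [t', hi] using hy i hi
        · simp [t', hi]
      rw [← Finset.prod_subset (Finset.subset_union_right : x.support ⊆ s ∪ x.support)]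
      · refine Finset.prod_congr rfl fun i hi => ?_
        simp only [h, Set.indicator_of_mem (hy' i), hi, if_true]
      · intro i _ hi
        simp only [h, Set.indicator_of_mem (hy' i), hi, if_false, Pi.one_apply]
    · rw [Set.indicator_of_notMem hy]
      obtain ⟨i, hi, hyi⟩ : ∃ i ∈ s, y i ∉ t i := by
        simpa [Set.mem_pi] using hy
      symm
      refine Finset.prod_eq_zero (Finset.mem_union_left _ hi) ?_
      exact Set.indicator_of_notMem (by simpa [t', hi] using hyi) _
  simp only [hprod]
  have hind : iIndepFun (fun i (y : ℕ → ℝ) => h i (y i)) gaussianProd :=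
    iIndepFun_infinitePi hh
  rw [lintegral_prod_eq_prod_lintegral_of_indepFun (s ∪ x.support)
    (fun i (y : ℕ → ℝ) => h i (y i)) hind fun i => (hh i).comp (measurable_pi_apply i)]
  have hmarg : ∀ i, ∫⁻ y, h i (y i) ∂gaussianProd = gaussianReal (x i) 1 (t' i) := by
    intro i
    rw [← hint i, ← (measurePreserving_eval_infinitePi (fun _ : ℕ => gaussianReal 0 1)
      i).lintegral_comp (hh i)]
    rfl
  simp only [hmarg]
  rw [← Finset.prod_subset (Finset.subset_union_left : s ⊆ s ∪ x.support)]
  · exact Finset.prod_congr rfl fun i hi => by simp [t', hi]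
  · intro i _ hi
    simp [t', hi]

/-- The Koopman operator `U_x` on `L²(ℝ^ℕ)` of the translation by `x ∈ ℝ^∞`. -/
def koopmanTranslate (x : ℕ →₀ ℝ) : Lp ℂ 2 gaussianProd →ₗᵢ[ℂ] Lp ℂ 2 gaussianProd :=
  koopman (seqTranslate x) (map_seqTranslate_absolutelyContinuous x)

/-! ### The representation `V^A` -/

/-- The set `X` of all sequences `a` of non-positive reals for which the infinite product
`∏ₙ γ([aₙ, ∞))` is positive, where `γ` is the standard Gaussian measure. The partial products
decrease, so that the infinite product always exists, as their limit. -/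
def admissibleSeq : Set (ℕ → ℝ) :=
  {a | (∀ n, a n ≤ 0) ∧ ∃ L : ℝ, 0 < L ∧
    Tendsto (fun N => ∏ n ∈ Finset.range N, (gaussianReal 0 1).real (Set.Ici (a n)))
      atTop (𝓝 L)}

/-- `A = ∏ₙ [aₙ, ∞)`. -/
def boxSet (a : ℕ → ℝ) : Set (ℕ → ℝ) := {y | ∀ n, a n ≤ y n}

theorem measurableSet_boxSet (a : ℕ → ℝ) : MeasurableSet (boxSet a) := by
  simp only [boxSet, Set.ofPred_forall]
  exact MeasurableSet.iInter fun n => measurableSet_le measurable_const (measurable_pi_apply n)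

/-- `L²(A)` as a subspace of `L²(ℝ^ℕ)`: the elements which vanish almost everywhere off `A`. -/
def L2Box (a : ℕ → ℝ) : Submodule ℂ (Lp ℂ 2 gaussianProd) where
  carrier := {f | ∀ᵐ y ∂gaussianProd, y ∉ boxSet a → f y = 0}
  add_mem' {f g} hf hg := by
    simp only [Set.mem_ofPred_eq] at hf hg ⊢
    filter_upwards [hf, hg, Lp.coeFn_add f g] with y h1 h2 h3 hy
    rw [h3, Pi.add_apply, h1 hy, h2 hy, add_zero]
  zero_mem' := by
    simp only [Set.mem_ofPred_eq]
    filter_upwards [Lp.coeFn_zero ℂ 2 gaussianProd] with y h1 _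
    rw [h1, Pi.zero_apply]
  smul_mem' c f hf := by
    simp only [Set.mem_ofPred_eq] at hf ⊢
    filter_upwards [hf, Lp.coeFn_smul c f] with y h1 h3 hy
    rw [h3, Pi.smul_apply, h1 hy, smul_zero]

theorem isClosed_L2Box (a : ℕ → ℝ) : IsClosed (L2Box a : Set (Lp ℂ 2 gaussianProd)) := by
  have h : (L2Box a : Set (Lp ℂ 2 gaussianProd)) =
      LpToLpRestrictCLM (ℕ → ℝ) ℂ ℂ gaussianProd 2 (boxSet a)ᶜ ⁻¹' {0} := by
    ext f
    rw [Set.mem_preimage, Set.mem_singleton_iff, Lp.eq_zero_iff_ae_eq_zero]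
    have h1 := LpToLpRestrictCLM_coeFn (F := ℂ) ℂ (boxSet a)ᶜ f
    have h2 : f ∈ (L2Box a : Set (Lp ℂ 2 gaussianProd)) ↔
        ⇑f =ᵐ[gaussianProd.restrict (boxSet a)ᶜ] 0 := by
      rw [EventuallyEq, ae_restrict_iff' (measurableSet_boxSet a).compl]
      rfl
    rw [h2]
    exact ⟨fun h => h1.trans h, fun h => h1.symm.trans h⟩
  rw [h]
  exact isClosed_singleton.preimage (ContinuousLinearMap.continuous _)

instance instCompleteSpaceL2Box (a : ℕ → ℝ) : CompleteSpace (L2Box a) :=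
  (isClosed_L2Box a).completeSpace_coe

theorem koopmanTranslate_mem_L2Box (a : ℕ → ℝ) (x : RPlusInf) {f : Lp ℂ 2 gaussianProd}
    (hf : f ∈ L2Box a) : koopmanTranslate x.1 f ∈ L2Box a := by
  have hf' : ⇑f =ᵐ[gaussianProd] (boxSet a).indicator f := by
    have hf : ∀ᵐ y ∂gaussianProd, y ∉ boxSet a → f y = 0 := hf
    filter_upwards [hf] with y hy
    by_cases h : y ∈ boxSet a
    · simp [h]
    · simp [h, hy h]
  have h := map_seqTranslate_absolutelyContinuous x.1
  change ∀ᵐ y ∂gaussianProd, y ∉ boxSet a → koopmanTranslate x.1 f y = 0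
  filter_upwards [coeFn_koopman (seqTranslate x.1) h f, koopmanFun_congr _ h hf'] with y h1 h2 hy
  have h3 : (seqTranslate x.1).symm y ∉ boxSet a := by
    intro hmem
    apply hy
    intro n
    have h4 := hmem n
    have h5 : (seqTranslate x.1).symm y n = -x.1 n + y n := rfl
    have h6 := x.2 n
    simp only [Finsupp.coe_zero, Pi.zero_apply] at h6
    linarith
  rw [koopmanTranslate, h1, h2, koopmanFun, Set.indicator_of_notMem h3, mul_zero]

/-- The representation `V^A` of `ℝ₊^∞`: `V^A_x` is the restriction of `U_x` to `L²(A)`. -/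
def boxRep (a : ℕ → ℝ) (x : RPlusInf) : L2Box a →L[ℂ] L2Box a :=
  ((koopmanTranslate x.1).toContinuousLinearMap.comp (L2Box a).subtypeL).codRestrict (L2Box a)
    fun f => koopmanTranslate_mem_L2Box a x f.2

end

open MeasureTheory ProbabilityTheory Filter Topology
open scoped NNReal ENNReal

noncomputable section

/-! A finitely supported translation changes only finitely many Gaussian coordinates, so `U_x f (y)
= w_x(y) f(y - x)` with the explicit weight `w_x = translateWeight x`, whose square is the density.
The weights satisfy a cocycle identity, so `U` is a unitary group. The adjoint `V_x^*` is `U_{-x}`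
followed by restriction to `A`, and `P_x = V_x V_x^*` is multiplication by the indicator of `A + x`
(`coeFn_boxRep_adjoint_boxRep`). Double commutation is then a pointwise comparison of supports, and
strong purity holds because the sets `A + t eᵢ` shrink to the empty set.

For irreducibility, let `g_n` be the restriction to `A` of `∏_{i<n} exp (yᵢ²/4 - yᵢ/2)`. It lies in
`L²(A)` and is a joint eigenvector of `V_x^*` for all `x` supported in the first `n` coordinates
(`adjoint_boxRep_headVector`). If `R` is in the commutant and `⟨g_n, R g_n⟩ = 0`, the eigenvector
property gives `⟨g_n, R P_x g_n⟩ = 0`; since `P_x P_{x'} = P_{x ⊔ x'}`, also `⟨P_x g_n, R P_{x'}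
g_n⟩ = 0`. The boxes `A + x` form a π-system generating, within `A`, the σ-algebra of the first `n`
coordinates, and `g_n` can be divided out, so the matrix coefficients of `R` vanish on all
indicators from that σ-algebra. Applied to `R - c_n`, this makes `R` act as the scalar `c_n` in
these coefficients. Testing on the nonzero vector `1_A` shows that `c_n` does not depend on `n`, and
cylinder indicators are total in `L²(A)`, so `R` is scalar. -/

/-! ### Explicit form of the Koopman operators of translations -/

/-- The square root of the density of the translate by `x` of the Gaussian product measure. -/
def translateWeight (x : ℕ →₀ ℝ) (y : ℕ → ℝ) : ℝ :=
  Real.exp (∑ i ∈ x.support, (x i * y i / 2 - x i ^ 2 / 4))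

theorem translateWeight_eq {x : ℕ →₀ ℝ} {s : Finset ℕ} (hs : x.support ⊆ s) (y : ℕ → ℝ) :
    translateWeight x y = Real.exp (∑ i ∈ s, (x i * y i / 2 - x i ^ 2 / 4)) := by
  rw [translateWeight, Finset.sum_subset hs]
  intro i _ hi
  have : x i = 0 := by simpa using hi
  simp [this]

theorem translateWeight_pos (x : ℕ →₀ ℝ) (y : ℕ → ℝ) : 0 < translateWeight x y :=
  Real.exp_pos _

@[fun_prop]
theorem measurable_translateWeight (x : ℕ →₀ ℝ) : Measurable (translateWeight x) := by
  unfold translateWeight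
  fun_prop

theorem translateWeight_zero (y : ℕ → ℝ) : translateWeight 0 y = 1 := by
  simp [translateWeight]

/-- The cross term `-xᵢ x'ᵢ / 2` from expanding the square is produced by evaluating the second
weight at `y - x`. This cocycle identity is what makes `x ↦ U_x` multiplicative. -/
theorem translateWeight_add (x x' : ℕ →₀ ℝ) (y : ℕ → ℝ) :
    translateWeight (x + x') y = translateWeight x y * translateWeight x' (-⇑x + y) := by
  classical
  rw [translateWeight_eq (Finsupp.support_add (g₁ := x) (g₂ := x')),
    translateWeight_eq (Finset.subset_union_left (s₁ := x.support) (s₂ := x'.support)),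
    translateWeight_eq (Finset.subset_union_right (s₁ := x.support) (s₂ := x'.support)),
    ← Real.exp_add, ← Finset.sum_add_distrib]
  congr 1
  refine Finset.sum_congr rfl fun i _ => ?_
  simp only [Finsupp.coe_add, Pi.add_apply, Pi.neg_apply]
  ring

theorem gaussianReal_eq_withDensity_zero (m : ℝ) :
    gaussianReal m 1 = (gaussianReal 0 1).withDensity
      (fun z => ENNReal.ofReal (Real.exp (m * z - m ^ 2 / 2))) := by
  rw [gaussianReal_of_var_ne_zero _ one_ne_zero, gaussianReal_of_var_ne_zero _ one_ne_zero,
    ← withDensity_mul _ (measurable_gaussianPDF 0 1) (by fun_prop)]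
  congr 1
  ext z
  simp only [Pi.mul_apply, gaussianPDF, ← ENNReal.ofReal_mul (gaussianPDFReal_nonneg 0 1 z)]
  congr 1
  simp only [gaussianPDFReal, mul_assoc, ← Real.exp_add]
  congr 2
  simp
  ring

theorem lintegral_prod_gaussianProd (s : Finset ℕ) (h : ℕ → ℝ → ℝ≥0∞)
    (hh : ∀ i, Measurable (h i)) :
    ∫⁻ y, ∏ i ∈ s, h i (y i) ∂gaussianProd = ∏ i ∈ s, ∫⁻ z, h i z ∂(gaussianReal 0 1) := by
  have hind : iIndepFun (fun i (y : ℕ → ℝ) => h i (y i)) gaussianProd :=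
    iIndepFun_infinitePi hh
  rw [lintegral_prod_eq_prod_lintegral_of_indepFun s
    (fun i (y : ℕ → ℝ) => h i (y i)) hind fun i => (hh i).comp (measurable_pi_apply i)]
  refine Finset.prod_congr rfl fun i _ => ?_
  rw [← (measurePreserving_eval_infinitePi (fun _ : ℕ => gaussianReal 0 1)
      i).lintegral_comp (hh i)]
  rfl

/-- Cameron–Martin for finitely supported shifts: the density is a finite product of one-dimensional
densities, so independence gives the right mass on every cylinder rectangle, and these determine the
product measure. -/
theorem map_seqTranslate_eq_withDensity (x : ℕ →₀ ℝ) :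
    gaussianProd.map (seqTranslate x) =
      gaussianProd.withDensity fun y => ENNReal.ofReal (translateWeight x y ^ 2) := by
  classical
  let ρ : ℕ → ℝ → ℝ≥0∞ := fun i z => ENNReal.ofReal (Real.exp (x i * z - x i ^ 2 / 2))
  have hρ : ∀ i, Measurable (ρ i) := fun i => by fun_prop
  have hw : ∀ (s : Finset ℕ) (y : ℕ → ℝ), x.support ⊆ s →
      ENNReal.ofReal (translateWeight x y ^ 2) = ∏ i ∈ s, ρ i (y i) := by
    intro s y hs
    rw [← ENNReal.ofReal_prod_of_nonneg fun _ _ => (Real.exp_pos _).le, ← Real.exp_sum,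
      translateWeight_eq hs, ← Real.exp_nat_mul, Finset.mul_sum]
    congr 2
    refine Finset.sum_congr rfl fun i _ => ?_
    push_cast
    ring
  rw [map_seqTranslate_gaussianProd]
  symm
  refine Measure.eq_infinitePi _ fun s t ht => ?_
  -- Padding with `univ` lets all products run over `s ∪ x.support`; the extra factors have mass
  -- one.
  let t' : ℕ → Set ℝ := fun i => if i ∈ s then t i else Set.univ
  have ht' : ∀ i, MeasurableSet (t' i) := fun i => by
    by_cases hi : i ∈ s <;> simp [t', hi, ht i]
  have hpi : MeasurableSet ((s : Set ℕ).pi t) :=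
    MeasurableSet.pi s.countable_toSet fun i _ => ht i
  have hprod : ∀ y : ℕ → ℝ,
      ((s : Set ℕ).pi t).indicator (fun y => ENNReal.ofReal (translateWeight x y ^ 2)) y =
        ∏ i ∈ s ∪ x.support, (t' i).indicator (ρ i) (y i) := by
    intro y
    by_cases hy : y ∈ (s : Set ℕ).pi t
    · rw [Set.indicator_of_mem hy, hw _ y Finset.subset_union_right]
      refine Finset.prod_congr rfl fun i _ => ?_
      rw [Set.indicator_of_mem]
      by_cases hi : i ∈ s
      · simpa [t', hi] using hy i hi
      · simp [t', hi]
    · rw [Set.indicator_of_notMem hy]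
      obtain ⟨i, hi, hyi⟩ : ∃ i ∈ s, y i ∉ t i := by
        simpa [Set.mem_pi] using hy
      symm
      refine Finset.prod_eq_zero (Finset.mem_union_left _ hi) ?_
      exact Set.indicator_of_notMem (by simpa [t', hi] using hyi) _
  have hint : ∀ i, ∫⁻ z, (t' i).indicator (ρ i) z ∂(gaussianReal 0 1) =
      gaussianReal (x i) 1 (t' i) := by
    intro i
    rw [lintegral_indicator (ht' i), gaussianReal_eq_withDensity_zero (x i),
      withDensity_apply _ (ht' i)]
  rw [withDensity_apply _ hpi, ← lintegral_indicator hpi]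
  simp only [hprod]
  rw [lintegral_prod_gaussianProd _ (fun i => (t' i).indicator (ρ i))
    fun i => (hρ i).indicator (ht' i)]
  simp only [hint]
  rw [← Finset.prod_subset (Finset.subset_union_left : s ⊆ s ∪ x.support)]
  · exact Finset.prod_congr rfl fun i hi => by simp [t', hi]
  · intro i _ hi
    simp [t', hi]

theorem coeFn_koopmanTranslate (x : ℕ →₀ ℝ) (f : Lp ℂ 2 gaussianProd) :
    koopmanTranslate x f =ᵐ[gaussianProd]
      fun y => (translateWeight x y : ℂ) * f (-⇑x + y) := by
  have h1 := Measure.rnDeriv_withDensity gaussianProd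
    (f := fun y => ENNReal.ofReal (translateWeight x y ^ 2)) (by fun_prop)
  rw [← map_seqTranslate_eq_withDensity] at h1
  filter_upwards [coeFn_koopman (seqTranslate x) (map_seqTranslate_absolutelyContinuous x) f, h1]
    with y h2 h3
  rw [koopmanTranslate, h2, koopmanFun, h3, ENNReal.toReal_ofReal (sq_nonneg _),
    Real.sqrt_sq (translateWeight_pos x y).le]
  rfl

theorem ae_translate (x : ℕ →₀ ℝ) {p : (ℕ → ℝ) → Prop} (h : ∀ᵐ y ∂gaussianProd, p y) :
    ∀ᵐ y ∂gaussianProd, p (⇑x + y) :=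
  ae_of_ae_map (seqTranslate x).measurable.aemeasurable
    ((map_seqTranslate_absolutelyContinuous x).ae_le h)

theorem ae_translate_neg (x : ℕ →₀ ℝ) {p : (ℕ → ℝ) → Prop} (h : ∀ᵐ y ∂gaussianProd, p y) :
    ∀ᵐ y ∂gaussianProd, p (-⇑x + y) := by
  simpa using ae_translate (-x) h

theorem koopmanTranslate_zero (f : Lp ℂ 2 gaussianProd) : koopmanTranslate 0 f = f := by
  refine Lp.ext ?_
  filter_upwards [coeFn_koopmanTranslate 0 f] with y hy
  rw [hy]
  simp [translateWeight_zero]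

theorem koopmanTranslate_add (x x' : ℕ →₀ ℝ) (f : Lp ℂ 2 gaussianProd) :
    koopmanTranslate (x + x') f = koopmanTranslate x (koopmanTranslate x' f) := by
  refine Lp.ext ?_
  filter_upwards [coeFn_koopmanTranslate (x + x') f,
    coeFn_koopmanTranslate x (koopmanTranslate x' f),
    ae_translate_neg x (coeFn_koopmanTranslate x' f)] with y h1 h2 h3
  rw [h1, h2, h3, translateWeight_add]
  have : -⇑(x + x') + y = -⇑x' + (-⇑x + y) := by
    ext i; simp only [Finsupp.coe_add, Pi.add_apply, Pi.neg_apply]; ring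
  rw [this]
  push_cast
  ring

theorem inner_koopmanTranslate_left (x : ℕ →₀ ℝ) (f g : Lp ℂ 2 gaussianProd) :
    inner ℂ (koopmanTranslate x f) g = inner ℂ f (koopmanTranslate (-x) g) := by
  rw [← (koopmanTranslate x).inner_map_map f, ← koopmanTranslate_add, add_neg_cancel,
    koopmanTranslate_zero]

/-! ### Strong continuity -/

theorem integrable_prod_gaussianProd (s : Finset ℕ) (h : ℕ → ℝ → ℝ)
    (hh : ∀ i, Integrable (h i) (gaussianReal 0 1)) :
    Integrable (fun y : ℕ → ℝ => ∏ i ∈ s, h i (y i)) gaussianProd := by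
  have h1 : Integrable (fun z : s → ℝ => ∏ i : s, h i (z i))
      (Measure.pi fun _ : s => gaussianReal 0 1) :=
    Integrable.fintype_prod fun i => hh i
  rw [← Measure.infinitePi_map_restrict (fun _ : ℕ => gaussianReal 0 1) (I := s)] at h1
  refine (h1.comp_measurable (by fun_prop)).congr (ae_of_all _ fun y => ?_)
  exact Finset.prod_coe_sort s fun i => h i (y i)

theorem inclRInf_apply (n : ℕ) (v : Fin n → ℝ) (i : ℕ) :
    inclRInf n v i = if h : i < n then v ⟨i, h⟩ else 0 := by
  classical
  simp only [inclRInf, Finsupp.coe_finsetSum, Finset.sum_apply, Finsupp.single_apply]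
  split_ifs with h
  · rw [Finset.sum_eq_single ⟨i, h⟩] <;> simp +contextual [Fin.ext_iff]
  · exact Finset.sum_eq_zero fun j _ => if_neg fun hj : (j : ℕ) = i => h (hj ▸ j.2)

theorem support_inclRInf_subset (n : ℕ) (v : Fin n → ℝ) :
    (inclRInf n v).support ⊆ Finset.range n := by
  intro i hi
  rw [Finsupp.mem_support_iff, inclRInf_apply] at hi
  by_contra h
  simp only [Finset.mem_range] at h
  simp [h] at hi

theorem continuous_inclRInf_apply (n i : ℕ) : Continuous fun v : Fin n → ℝ => inclRInf n v i := by
  simp only [inclRInf_apply]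
  split_ifs <;> fun_prop

theorem integrable_exp_mul_abs_gaussianReal (r : ℝ) :
    Integrable (fun z => Real.exp (r * |z|)) (gaussianReal 0 1) := by
  refine integrable_exp_mul_abs ?_ ?_ <;> exact integrable_exp_mul_gaussianReal _

theorem translateWeight_le {n : ℕ} {x : ℕ →₀ ℝ} (hx : x.support ⊆ Finset.range n) {r : ℝ}
    (hr : ∀ i, |x i| ≤ r) (y : ℕ → ℝ) :
    translateWeight x y ≤ ∏ i ∈ Finset.range n, Real.exp (r / 2 * |y i|) := by
  rw [translateWeight_eq hx, ← Real.exp_sum]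
  refine Real.exp_le_exp.mpr (Finset.sum_le_sum fun i _ => ?_)
  have h1 : x i * y i ≤ r * |y i| := (le_abs_self _).trans <| by
    rw [abs_mul]; exact mul_le_mul_of_nonneg_right (hr i) (abs_nonneg _)
  nlinarith [sq_nonneg (x i)]

/-- With equal norms, `‖u - b‖² = 2‖b‖² - 2 Re ⟨u, b⟩`, so convergence of the inner products
suffices. -/
theorem tendsto_of_tendsto_inner_of_norm_eq {ι E : Type*} [NormedAddCommGroup E]
    [InnerProductSpace ℂ E] {l : Filter ι} {u : ι → E} {b : E} (hu : ∀ i, ‖u i‖ = ‖b‖)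
    (h : Tendsto (fun i => inner ℂ (u i) b) l (𝓝 (inner ℂ b b))) : Tendsto u l (𝓝 b) := by
  rw [tendsto_iff_norm_sub_tendsto_zero]
  have h1 : Tendsto (fun i => ‖u i - b‖ ^ 2) l (𝓝 0) := by
    have h2 := (Complex.continuous_re.tendsto _).comp h
    have h3 := ((h2.const_mul 2).const_sub (‖b‖ ^ 2)).add_const (‖b‖ ^ 2)
    refine (h3.congr fun i => ?_).trans (le_of_eq ?_)
    · rw [norm_sub_sq (𝕜 := ℂ), hu]; rfl
    · have : (inner ℂ b b : ℂ).re = ‖b‖ ^ 2 := inner_self_eq_norm_sq (𝕜 := ℂ) b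
      rw [this]; ring_nf
  simpa [Function.comp_def, Real.sqrt_sq (norm_nonneg _)] using
    (Real.continuous_sqrt.tendsto _).comp h1

theorem continuous_koopmanTranslate_toLp (n : ℕ) (f : BoundedContinuousFunction (ℕ → ℝ) ℂ) :
    Continuous fun v : Fin n → ℝ =>
      koopmanTranslate (inclRInf n v) (BoundedContinuousFunction.toLp 2 gaussianProd ℂ f) := by
  rw [continuous_iff_continuousAt]
  intro w
  refine tendsto_of_tendsto_inner_of_norm_eq (fun v => by simp) ?_
  have hform : ∀ v : Fin n → ℝ,
      (inner ℂ (koopmanTranslate (inclRInf n v) (BoundedContinuousFunction.toLp 2 gaussianProd ℂ f))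
        (koopmanTranslate (inclRInf n w) (BoundedContinuousFunction.toLp 2 gaussianProd ℂ f)) : ℂ) =
      ∫ y, inner ℂ ((translateWeight (inclRInf n v) y : ℂ) * f (-⇑(inclRInf n v) + y))
        ((translateWeight (inclRInf n w) y : ℂ) * f (-⇑(inclRInf n w) + y)) ∂gaussianProd := by
    intro v
    rw [L2.inner_def]
    have hf := BoundedContinuousFunction.coeFn_toLp (E := ℂ) gaussianProd (p := 2) (𝕜 := ℂ) f
    refine integral_congr_ae ?_
    filter_upwards [coeFn_koopmanTranslate (inclRInf n v)
        (BoundedContinuousFunction.toLp 2 gaussianProd ℂ f),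
      coeFn_koopmanTranslate (inclRInf n w) (BoundedContinuousFunction.toLp 2 gaussianProd ℂ f),
      ae_translate_neg (inclRInf n v) hf, ae_translate_neg (inclRInf n w) hf] with y h1 h2 h3 h4
    rw [h1, h2, h3, h4]
  simp only [hform]
  have hbd : ∀ (r : ℝ) (v : Fin n → ℝ), ‖v‖ ≤ r → ∀ i, |inclRInf n v i| ≤ r := by
    intro r v hv i
    rw [inclRInf_apply]
    split_ifs with h
    · exact (norm_le_pi_norm v ⟨i, h⟩).trans hv
    · simpa using (norm_nonneg v).trans hv
  -- Near `w` one has `‖v‖ < ‖w‖ + 1`, so each of the two weights is at most `∏ exp ((‖w‖ + 1) / 2 *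
  -- |yᵢ|)`; their product has Gaussian-integrable factors.
  refine tendsto_integral_filter_of_dominated_convergence
    (fun y => (∏ i ∈ Finset.range n, Real.exp ((‖w‖ + 1) * |y i|)) * (‖f‖ * ‖f‖)) ?_ ?_ ?_ ?_
  · refine Eventually.of_forall fun v => ?_
    have hf : Measurable f := f.continuous.measurable
    apply AEStronglyMeasurable.inner <;> apply Measurable.aestronglyMeasurable <;> fun_prop
  · have hev : ∀ᶠ v in 𝓝 w, ‖v‖ < ‖w‖ + 1 :=
      continuous_norm.continuousAt.eventually_lt continuousAt_const (lt_add_one _)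
    filter_upwards [hev] with v hv
    refine ae_of_all _ fun y => (norm_inner_le_norm _ _).trans ?_
    rw [norm_mul, norm_mul, Complex.norm_real, Complex.norm_real,
      Real.norm_of_nonneg (translateWeight_pos _ _).le,
      Real.norm_of_nonneg (translateWeight_pos _ _).le, mul_mul_mul_comm]
    have h1 := translateWeight_le (support_inclRInf_subset n v) (hbd _ v hv.le) y
    have h2 := translateWeight_le (support_inclRInf_subset n w)
      (hbd (‖w‖ + 1) w (by linarith)) y
    have h3 : ∏ i ∈ Finset.range n, Real.exp ((‖w‖ + 1) * |y i|) =
        (∏ i ∈ Finset.range n, Real.exp ((‖w‖ + 1) / 2 * |y i|)) *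
        ∏ i ∈ Finset.range n, Real.exp ((‖w‖ + 1) / 2 * |y i|) := by
      rw [← Finset.prod_mul_distrib]
      refine Finset.prod_congr rfl fun i _ => ?_
      rw [← Real.exp_add]; ring_nf
    rw [h3]
    have h4 := (translateWeight_pos (inclRInf n v) y).le
    have h5 := (translateWeight_pos (inclRInf n w) y).le
    gcongr
    · exact f.norm_coe_le_norm _
    · exact f.norm_coe_le_norm _
  · exact (integrable_prod_gaussianProd _ (fun _ z => Real.exp ((‖w‖ + 1) * |z|))
      fun _ => integrable_exp_mul_abs_gaussianReal _).mul_const _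
  · refine ae_of_all _ fun y => ?_
    have hc : Continuous fun v : Fin n → ℝ => -⇑(inclRInf n v) + y :=
      continuous_pi fun i => (continuous_inclRInf_apply n i).neg.add continuous_const
    have hw : Continuous fun v : Fin n → ℝ => translateWeight (inclRInf n v) y := by
      simp only [translateWeight_eq (support_inclRInf_subset n _)]
      have := fun i => continuous_inclRInf_apply n i
      fun_prop
    have hall : Continuous fun v : Fin n → ℝ =>
        inner ℂ ((translateWeight (inclRInf n v) y : ℂ) * f (-⇑(inclRInf n v) + y))
        ((translateWeight (inclRInf n w) y : ℂ) * f (-⇑(inclRInf n w) + y)) :=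
      Continuous.inner ((Complex.continuous_ofReal.comp hw).mul (f.continuous.comp hc))
        continuous_const
    exact hall.tendsto w

theorem continuous_koopmanTranslate (f : Lp ℂ 2 gaussianProd) :
    Continuous fun x : ℕ →₀ ℝ => koopmanTranslate x f := by
  rw [continuous_iSup_dom]
  intro n
  rw [continuous_coinduced_dom]
  -- Because `U` is isometric, approximating `f` by a bounded continuous function gives an error
  -- that is uniform in `v`.
  refine continuous_of_uniform_approx_of_continuous ?_
  rw [Metric.uniformity_basis_dist.forall_iff (by
    intro u v huv h
    obtain ⟨F, hF, h⟩ := h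
    exact ⟨F, hF, fun y => huv (h y)⟩)]
  intro ε hε
  obtain ⟨b, hb⟩ := (BoundedContinuousFunction.toLp_denseRange ℂ gaussianProd ℂ
    (p := 2) (by norm_num)).exists_dist_lt f hε
  refine ⟨_, continuous_koopmanTranslate_toLp n b, fun v => ?_⟩
  simpa using hb

/-! ### The adjoints of the operators `V^A_x` -/

theorem ae_eq_zero_of_mem_L2Box {a : ℕ → ℝ} (f : L2Box a) :
    ∀ᵐ y ∂gaussianProd, y ∉ boxSet a → (f : Lp ℂ 2 gaussianProd) y = 0 :=
  f.2

theorem L2Box_ext {a : ℕ → ℝ} {f g : L2Box a}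
    (h : ∀ᵐ y ∂gaussianProd, (f : Lp ℂ 2 gaussianProd) y = (g : Lp ℂ 2 gaussianProd) y) : f = g :=
  Subtype.ext (Lp.ext h)

/-- The inner product of `L²(A)`; instance search would otherwise prefer the one coming from the
structure of a Hilbert module over `ℂ`. -/
instance instInnerL2Box (a : ℕ → ℝ) : Inner ℂ (L2Box a) :=
  (Submodule.innerProductSpace (L2Box a)).toInner

theorem inner_L2Box {a : ℕ → ℝ} (f g : L2Box a) :
    inner ℂ f g = ∫ y, inner ℂ ((f : Lp ℂ 2 gaussianProd) y) ((g : Lp ℂ 2 gaussianProd) y)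
      ∂gaussianProd :=
  rfl

theorem inner_smul_left_L2Box {a : ℕ → ℝ} (c : ℂ) (f g : L2Box a) :
    inner ℂ (c • f) g = starRingEnd ℂ c * inner ℂ f g :=
  inner_smul_left (𝕜 := ℂ) f g c

theorem inner_smul_right_L2Box {a : ℕ → ℝ} (c : ℂ) (f g : L2Box a) :
    inner ℂ f (c • g) = c * inner ℂ f g :=
  inner_smul_right (𝕜 := ℂ) f g c

/-- The element of `L²(A)` given by the restriction to `A` of a square integrable function. -/
def toL2Box (a : ℕ → ℝ) {f : (ℕ → ℝ) → ℂ} (hf : MemLp f 2 gaussianProd) : L2Box a :=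
  ⟨(hf.indicator (measurableSet_boxSet a)).toLp _, by
    change ∀ᵐ y ∂gaussianProd, y ∉ boxSet a → _ = (0 : ℂ)
    filter_upwards [(hf.indicator (measurableSet_boxSet a)).coeFn_toLp] with y h1 h2
    rw [h1, Set.indicator_of_notMem h2]⟩

theorem coeFn_toL2Box (a : ℕ → ℝ) {f : (ℕ → ℝ) → ℂ} (hf : MemLp f 2 gaussianProd) :
    (toL2Box a hf : Lp ℂ 2 gaussianProd) =ᵐ[gaussianProd] (boxSet a).indicator f :=
  (hf.indicator (measurableSet_boxSet a)).coeFn_toLp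

theorem coeFn_boxRep (a : ℕ → ℝ) (x : RPlusInf) (f : L2Box a) :
    (boxRep a x f : Lp ℂ 2 gaussianProd) =ᵐ[gaussianProd]
      fun y => (translateWeight x.1 y : ℂ) * (f : Lp ℂ 2 gaussianProd) (-⇑x.1 + y) :=
  coeFn_koopmanTranslate x.1 f

/-- The adjoint of a restriction is the compression of `U_x^* = U_{-x}`; the cut-off to `A` is
needed because translation by `-x` may leave `A`. -/
theorem adjoint_boxRep_apply (a : ℕ → ℝ) (x : RPlusInf) (f : L2Box a) :
    ContinuousLinearMap.adjoint (boxRep a x) f =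
      toL2Box a (Lp.memLp (koopmanTranslate (-x.1) (f : Lp ℂ 2 gaussianProd))) := by
  refine ext_inner_right ℂ fun g => ?_
  rw [ContinuousLinearMap.adjoint_inner_left]
  change inner ℂ (f : Lp ℂ 2 gaussianProd) (koopmanTranslate x.1 g) = _
  rw [← neg_neg x.1, ← inner_koopmanTranslate_left, neg_neg, inner_L2Box, L2.inner_def]
  refine integral_congr_ae ?_
  filter_upwards [coeFn_toL2Box a (Lp.memLp (koopmanTranslate (-x.1) (f : Lp ℂ 2 gaussianProd))),
    ae_eq_zero_of_mem_L2Box g] with y h1 h2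
  rw [h1]
  by_cases hy : y ∈ boxSet a
  · rw [Set.indicator_of_mem hy]
  · rw [h2 hy, inner_zero_right, inner_zero_right]

theorem coeFn_adjoint_boxRep (a : ℕ → ℝ) (x : RPlusInf) (f : L2Box a) :
    (ContinuousLinearMap.adjoint (boxRep a x) f : Lp ℂ 2 gaussianProd) =ᵐ[gaussianProd]
      (boxSet a).indicator fun y =>
        (translateWeight (-x.1) y : ℂ) * (f : Lp ℂ 2 gaussianProd) (⇑x.1 + y) := by
  rw [adjoint_boxRep_apply]
  filter_upwards [coeFn_toL2Box a (Lp.memLp (koopmanTranslate (-x.1) (f : Lp ℂ 2 gaussianProd))),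
    coeFn_koopmanTranslate (-x.1) f] with y h1 h2
  rw [h1]
  by_cases hy : y ∈ boxSet a
  · rw [Set.indicator_of_mem hy, Set.indicator_of_mem hy, h2]
    simp
  · rw [Set.indicator_of_notMem hy, Set.indicator_of_notMem hy]

/-- The two weights cancel by the cocycle identity, leaving the range projection of `V_x`. -/
theorem coeFn_boxRep_adjoint_boxRep (a : ℕ → ℝ) (x : RPlusInf) (f : L2Box a) :
    (boxRep a x (ContinuousLinearMap.adjoint (boxRep a x) f) : Lp ℂ 2 gaussianProd)
      =ᵐ[gaussianProd] (boxSet (a + x.1)).indicator (f : Lp ℂ 2 gaussianProd) := by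
  filter_upwards [coeFn_boxRep a x (ContinuousLinearMap.adjoint (boxRep a x) f),
    ae_translate_neg x.1 (coeFn_adjoint_boxRep a x f)] with y h1 h2
  rw [h1, h2]
  have hmem : -⇑x.1 + y ∈ boxSet a ↔ y ∈ boxSet (a + x.1) := by
    refine forall_congr' fun n => ?_
    simp only [Pi.add_apply, Pi.neg_apply]
    constructor <;> intro h <;> linarith
  by_cases hy : y ∈ boxSet (a + x.1)
  · rw [Set.indicator_of_mem hy, Set.indicator_of_mem (hmem.mpr hy), ← mul_assoc,
      ← Complex.ofReal_mul, ← translateWeight_add, add_neg_cancel, translateWeight_zero]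
    simp
  · rw [Set.indicator_of_notMem hy, Set.indicator_of_notMem (mt hmem.mp hy), mul_zero]

/-! ### The representation `V^A` is isometric, doubly commuting and strongly pure -/

theorem isIsometricRep_boxRep (a : ℕ → ℝ) : IsIsometricRep (boxRep a) where
  map_zero := by
    ext1 f
    exact Subtype.ext (koopmanTranslate_zero f)
  map_add x y := by
    ext1 f
    exact Subtype.ext (koopmanTranslate_add x.1 y.1 f)
  isometry x := AddMonoidHomClass.isometry_of_norm _ fun f => (koopmanTranslate x.1).norm_map f
  strongly_continuous ξ :=
    ((continuous_koopmanTranslate ξ).comp continuous_subtype_val).subtype_mk _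

theorem translateWeight_ray_translate {i j : ℕ} (hij : i ≠ j) (s t : ℝ) (y : ℕ → ℝ) :
    translateWeight (Finsupp.single i s) (⇑(Finsupp.single j t) + y) =
      translateWeight (Finsupp.single i s) y := by
  rw [translateWeight, translateWeight]
  congr 1
  refine Finset.sum_congr rfl fun k hk => ?_
  have : k = i := by simpa using Finsupp.support_single_subset hk
  subst this
  simp [hij.symm]

theorem isDoublyCommuting_boxRep (a : ℕ → ℝ) : IsDoublyCommuting (boxRep a) := by
  intro i j hij s t
  ext1 f
  refine L2Box_ext ?_
  have ht := t.2
  have hs := s.2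
  simp only [mul_apply_eq_comp]
  filter_upwards [coeFn_adjoint_boxRep a (RPlusInf.ray i t) (boxRep a (RPlusInf.ray j s) f),
    ae_translate (RPlusInf.ray i t).1 (coeFn_boxRep a (RPlusInf.ray j s) f),
    coeFn_boxRep a (RPlusInf.ray j s) (ContinuousLinearMap.adjoint (boxRep a (RPlusInf.ray i t)) f),
    ae_translate_neg (RPlusInf.ray j s).1 (coeFn_adjoint_boxRep a (RPlusInf.ray i t) f),
    ae_translate_neg (RPlusInf.ray j s).1 (ae_translate (RPlusInf.ray i t).1
      (ae_eq_zero_of_mem_L2Box f))] with y h1 h2 h3 h4 h5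
  rw [h1, h3, h4]
  simp only [RPlusInf.ray] at h2 h5 ⊢
  have hcomm : ⇑(Finsupp.single i (t : ℝ)) + (-⇑(Finsupp.single j (s : ℝ)) + y) =
      -⇑(Finsupp.single j (s : ℝ)) + (⇑(Finsupp.single i (t : ℝ)) + y) := add_left_comm _ _ _
  have hw1 : translateWeight (Finsupp.single j (s : ℝ)) (⇑(Finsupp.single i (t : ℝ)) + y) =
      translateWeight (Finsupp.single j (s : ℝ)) y := translateWeight_ray_translate hij.symm _ _ _
  have hw2 : translateWeight (-Finsupp.single i (t : ℝ)) (-⇑(Finsupp.single j (s : ℝ)) + y) =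
      translateWeight (-Finsupp.single i (t : ℝ)) y := by
    rw [← Finsupp.single_neg, ← Finsupp.coe_neg, ← Finsupp.single_neg]
    exact translateWeight_ray_translate hij _ _ _
  -- Both sides evaluate `f` at this point, so off `A` both vanish. If it lies in `A`, then `y j - s
  -- ≥ a j` because `i ≠ j`, hence both membership conditions hold in coordinate `j`; in the other
  -- coordinates they coincide.
  by_cases hy : ⇑(Finsupp.single i (t : ℝ)) + (-⇑(Finsupp.single j (s : ℝ)) + y) ∈ boxSet a
  · have hiff : y ∈ boxSet a ↔ -⇑(Finsupp.single j (s : ℝ)) + y ∈ boxSet a := by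
      refine forall_congr' fun k => ?_
      have hk := hy k
      simp only [Pi.add_apply, Pi.neg_apply, Finsupp.single_apply] at hk ⊢
      by_cases hjk : j = k
      · have hik : i ≠ k := fun h => hij (h.trans hjk.symm)
        simp only [hjk, hik, if_true, if_false] at hk ⊢
        constructor <;> intro h <;> linarith
      · simp [hjk]
    by_cases hyA : y ∈ boxSet a
    · rw [Set.indicator_of_mem hyA, Set.indicator_of_mem (hiff.mp hyA), h2, hw1, hw2, hcomm]
      ring
    · rw [Set.indicator_of_notMem hyA, Set.indicator_of_notMem (mt hiff.mpr hyA), mul_zero]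
  · have h6 := h5 hy
    rw [← hcomm, h6] at h2
    by_cases hyA : y ∈ boxSet a <;> by_cases hyB : -⇑(Finsupp.single j (s : ℝ)) + y ∈ boxSet a <;>
      simp [hyA, hyB, h2, h6]

theorem norm_adjoint_boxRep_sq (a : ℕ → ℝ) (x : RPlusInf) (f : L2Box a) :
    ‖ContinuousLinearMap.adjoint (boxRep a x) f‖ ^ 2 =
      ∫ y, (boxSet (a + x.1)).indicator (fun y => ‖(f : Lp ℂ 2 gaussianProd) y‖ ^ 2) y
        ∂gaussianProd := by
  have h1 : ((‖ContinuousLinearMap.adjoint (boxRep a x) f‖ ^ 2 : ℝ) : ℂ) =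
      inner ℂ (boxRep a x (ContinuousLinearMap.adjoint (boxRep a x) f)) f := by
    rw [← ContinuousLinearMap.adjoint_inner_right, inner_self_eq_norm_sq_to_K]
    push_cast
    rfl
  rw [← Complex.ofReal_inj, h1, inner_L2Box, ← integral_complex_ofReal]
  refine integral_congr_ae ?_
  filter_upwards [coeFn_boxRep_adjoint_boxRep a x f] with y hy
  rw [hy]
  by_cases h : y ∈ boxSet (a + x.1)
  · rw [Set.indicator_of_mem h, Set.indicator_of_mem h, inner_self_eq_norm_sq_to_K]
    push_cast
    rfl
  · rw [Set.indicator_of_notMem h, Set.indicator_of_notMem h, inner_zero_left]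
    simp

theorem isStronglyPure_boxRep (a : ℕ → ℝ) : IsStronglyPure (boxRep a) := by
  intro i ξ
  rw [tendsto_zero_iff_norm_tendsto_zero]
  have hint : Integrable (fun y => ‖(ξ : Lp ℂ 2 gaussianProd) y‖ ^ 2) gaussianProd :=
    (memLp_two_iff_integrable_sq_norm (Lp.aestronglyMeasurable _)).mp (Lp.memLp _)
  have h1 : Tendsto (fun t : ℝ≥0 =>
      ‖ContinuousLinearMap.adjoint (boxRep a (RPlusInf.ray i t)) ξ‖ ^ 2) atTop (𝓝 0) := by
    simp only [norm_adjoint_boxRep_sq]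
    rw [← integral_zero (ℕ → ℝ) ℝ (μ := gaussianProd)]
    refine tendsto_integral_filter_of_dominated_convergence
      (fun y => ‖(ξ : Lp ℂ 2 gaussianProd) y‖ ^ 2) ?_ ?_ hint ?_
    · exact Eventually.of_forall fun t =>
        hint.aestronglyMeasurable.indicator (measurableSet_boxSet _)
    · refine Eventually.of_forall fun t => ae_of_all _ fun y => ?_
      refine (norm_indicator_le_norm_self _ _).trans ?_
      simp
    · refine ae_of_all _ fun y => tendsto_const_nhds.congr' ?_
      -- For `t > y i - a i` the point `y` is no longer in `A + t eᵢ`.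
      filter_upwards [eventually_gt_atTop (y i - a i).toNNReal] with t ht
      rw [Set.indicator_of_notMem]
      intro h
      have h2 := h i
      simp only [RPlusInf.ray, Pi.add_apply, Finsupp.single_eq_same] at h2
      have h4 := Real.le_coe_toNNReal (y i - a i)
      have h5 : (((y i - a i).toNNReal : ℝ≥0) : ℝ) < t := ht
      linarith
  simpa [Function.comp_def, Real.sqrt_sq (norm_nonneg _)] using
    (Real.continuous_sqrt.tendsto _).comp h1

theorem separableSpace_L2Box (a : ℕ → ℝ) : TopologicalSpace.SeparableSpace (L2Box a) := by
  have : Fact ((2 : ℝ≥0∞) ≠ ∞) := ⟨by norm_num⟩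
  have : SecondCountableTopology (Lp ℂ 2 gaussianProd) := inferInstance
  infer_instance

/-! ### Integrals over the sets of a sub-σ-algebra -/

/-- A π-λ argument; `h0` supplies the whole space, which need not belong to `C`, and serves for
complements. -/
theorem setIntegral_eq_zero_of_generateFrom {Ω E : Type*} {m₀ : MeasurableSpace Ω} {μ : Measure Ω}
    [NormedAddCommGroup E] [NormedSpace ℝ E] {C : Set (Set Ω)}
    (hC : ∀ s ∈ C, MeasurableSet s) (hpi : IsPiSystem C) {f : Ω → E} (hf : Integrable f μ)
    (h0 : ∫ ω, f ω ∂μ = 0) (hCf : ∀ s ∈ C, ∫ ω in s, f ω ∂μ = 0) {s : Set Ω}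
    (hs : MeasurableSet[MeasurableSpace.generateFrom C] s) : ∫ ω in s, f ω ∂μ = 0 := by
  have hle : MeasurableSpace.generateFrom C ≤ m₀ := MeasurableSpace.generateFrom_le hC
  induction s, hs using MeasurableSpace.induction_on_inter rfl hpi with
  | empty => simp
  | basic t ht => exact hCf t ht
  | compl t ht ih =>
    have := integral_add_compl (hle t ht) hf
    rwa [ih, zero_add, h0] at this
  | iUnion t hd ht ih =>
    rw [integral_iUnion (fun i => hle _ (ht i)) hd hf.integrableOn]
    simp [ih]

/-- The hypothesis says that the conditional expectation of `f` given `m` is zero, and `ψ` can be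
pulled out of it. Only integrability of `ψ • f` is required, so `ψ` may be unbounded, as
`headTilt⁻¹` can be. -/
theorem integral_smul_eq_zero_of_setIntegral_eq_zero {Ω E : Type*} {m m₀ : MeasurableSpace Ω}
    {μ : Measure Ω} [IsFiniteMeasure μ] [NormedAddCommGroup E] [NormedSpace ℝ E] [CompleteSpace E]
    (hm : m ≤ m₀) {f : Ω → E} (hf : Integrable f μ)
    (h0 : ∀ s, MeasurableSet[m] s → ∫ ω in s, f ω ∂μ = 0) {ψ : Ω → ℝ}
    (hψ : StronglyMeasurable[m] ψ) (hψf : Integrable (ψ • f) μ) : ∫ ω, ψ ω • f ω ∂μ = 0 := by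
  have h1 : (0 : Ω → E) =ᵐ[μ] μ[f|m] := by
    refine ae_eq_condExp_of_forall_setIntegral_eq hm hf
      (fun s _ _ => (integrable_zero _ _ _).integrableOn)
      (fun s hs _ => by simp [h0 s hs]) stronglyMeasurable_zero.aestronglyMeasurable
  have h2 := condExp_smul_of_aestronglyMeasurable_left hψ.aestronglyMeasurable hψf hf
  change ∫ ω, (ψ • f) ω ∂μ = 0
  rw [← integral_condExp hm, integral_congr_ae h2]
  refine integral_eq_zero_of_ae ?_
  filter_upwards [h1] with ω hω
  simp [← hω]

/-! ### The σ-algebras generated by finitely many coordinates -/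

/-- The set of the sequences `y` with `sᵢ ≤ yᵢ` for all `i < n`. -/
def headBox (n : ℕ) (s : ℕ → ℝ) : Set (ℕ → ℝ) := {y | ∀ i < n, s i ≤ y i}

theorem measurableSet_headBox (n : ℕ) (s : ℕ → ℝ) : MeasurableSet (headBox n s) := by
  simp only [headBox, Set.ofPred_forall]
  exact MeasurableSet.iInter fun i => MeasurableSet.iInter fun _ =>
    measurableSet_le measurable_const (measurable_pi_apply i)

theorem isPiSystem_headBox (n : ℕ) : IsPiSystem (Set.range (headBox n)) := by
  rintro _ ⟨s, rfl⟩ _ ⟨t, rfl⟩ _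
  refine ⟨s ⊔ t, ?_⟩
  ext y
  simp only [headBox, Set.mem_ofPred_eq, Set.mem_inter_iff, Pi.sup_apply, sup_le_iff]
  exact ⟨fun h => ⟨fun i hi => (h i hi).1, fun i hi => (h i hi).2⟩,
    fun h i hi => ⟨h.1 i hi, h.2 i hi⟩⟩

/-- The σ-algebra on `ℝ^ℕ` generated by the first `n` coordinates. -/
abbrev headSigma (n : ℕ) : MeasurableSpace (ℕ → ℝ) :=
  MeasurableSpace.generateFrom (Set.range (headBox n))

theorem headSigma_le (n : ℕ) : headSigma n ≤ MeasurableSpace.pi :=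
  MeasurableSpace.generateFrom_le <| by
    rintro _ ⟨s, rfl⟩
    exact measurableSet_headBox n s

theorem measurable_eval_headSigma {n i : ℕ} (hi : i < n) :
    Measurable[headSigma n] fun y : ℕ → ℝ => y i := by
  let _ := headSigma n
  refine measurable_of_Ici fun c => ?_
  -- A head box bounds all of the first `n` coordinates, so a half-space is obtained as a union with
  -- the other lower bounds `-k` tending to `-∞`.
  have : (fun y : ℕ → ℝ => y i) ⁻¹' Set.Ici c =
      ⋃ k : ℕ, headBox n (Function.update (fun _ => -(k : ℝ)) i c) := by
    ext y
    simp only [headBox, Set.mem_preimage, Set.mem_Ici, Set.mem_iUnion, Set.mem_ofPred_eq]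
    constructor
    · intro h
      obtain ⟨k, hk⟩ := exists_nat_ge (∑ j ∈ Finset.range n, |y j|)
      refine ⟨k, fun j hj => ?_⟩
      by_cases hji : j = i
      · subst hji; simpa using h
      · rw [Function.update_of_ne hji]
        have h1 := Finset.single_le_sum (f := fun j => |y j|) (fun j _ => abs_nonneg _)
          (Finset.mem_range.mpr hj)
        have h2 := neg_abs_le (y j)
        linarith
    · rintro ⟨k, hk⟩
      simpa using hk i hi
  rw [this]
  exact MeasurableSet.iUnion fun k => MeasurableSpace.measurableSet_generateFrom ⟨_, rfl⟩

theorem headSigma_mono {n n' : ℕ} (h : n ≤ n') : headSigma n ≤ headSigma n' :=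
  MeasurableSpace.generateFrom_le <| by
    rintro _ ⟨s, rfl⟩
    let _ := headSigma n'
    simp only [headBox, Set.ofPred_forall]
    exact MeasurableSet.iInter fun i => MeasurableSet.iInter fun hi =>
      measurableSet_le measurable_const (measurable_eval_headSigma (hi.trans_le h))

/-- The sets which depend measurably on finitely many coordinates. -/
def headSets : Set (Set (ℕ → ℝ)) := {B | ∃ n, MeasurableSet[headSigma n] B}

theorem isPiSystem_headSets : IsPiSystem headSets := by
  rintro s ⟨n, hs⟩ t ⟨n', ht⟩ _
  exact ⟨max n n', MeasurableSet.inter (headSigma_mono (le_max_left n n') s hs)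
    (headSigma_mono (le_max_right n n') t ht)⟩

theorem generateFrom_headSets :
    MeasurableSpace.generateFrom headSets = (MeasurableSpace.pi : MeasurableSpace (ℕ → ℝ)) := by
  refine le_antisymm (MeasurableSpace.generateFrom_le ?_) (iSup_le fun i => ?_)
  · rintro s ⟨n, hs⟩
    exact headSigma_le n s hs
  · rintro _ ⟨t, ht, rfl⟩
    exact MeasurableSpace.measurableSet_generateFrom
      ⟨i + 1, measurable_eval_headSigma (Nat.lt_succ_self i) ht⟩

/-! ### Indicator functions in `L²(A)` -/

/-- The indicator function of `A ∩ B` as an element of `L²(A)`. -/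
def boxIndicator (a : ℕ → ℝ) {B : Set (ℕ → ℝ)} (hB : MeasurableSet B) : L2Box a :=
  toL2Box a ((memLp_const (1 : ℂ)).indicator hB)

theorem coeFn_boxIndicator (a : ℕ → ℝ) {B : Set (ℕ → ℝ)} (hB : MeasurableSet B) :
    (boxIndicator a hB : Lp ℂ 2 gaussianProd) =ᵐ[gaussianProd]
      (boxSet a).indicator (B.indicator fun _ => 1) :=
  coeFn_toL2Box a _

theorem inner_boxIndicator (a : ℕ → ℝ) {B : Set (ℕ → ℝ)} (hB : MeasurableSet B) (η : L2Box a) :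
    inner ℂ (boxIndicator a hB) η = ∫ y in B, (η : Lp ℂ 2 gaussianProd) y ∂gaussianProd := by
  rw [inner_L2Box, ← integral_indicator hB]
  refine integral_congr_ae ?_
  filter_upwards [coeFn_boxIndicator a hB, ae_eq_zero_of_mem_L2Box η] with y h1 h2
  rw [h1]
  by_cases hA : y ∈ boxSet a
  · by_cases h : y ∈ B <;> simp [hA, h]
  · by_cases h : y ∈ B <;> simp [hA, h, h2 hA]

theorem integrable_L2Box {a : ℕ → ℝ} (η : L2Box a) :
    Integrable (η : Lp ℂ 2 gaussianProd) gaussianProd :=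
  (Lp.memLp _).integrable (by norm_num)

/-- Totality of the cylinder indicators: these sets form a π-system generating the product
σ-algebra, so the integral of `η` over every measurable set vanishes. -/
theorem eq_zero_of_forall_inner_boxIndicator {a : ℕ → ℝ} {η : L2Box a}
    (h : ∀ (n : ℕ) (B : Set (ℕ → ℝ)) (hB : MeasurableSet[headSigma n] B),
      inner ℂ (boxIndicator a (headSigma_le n B hB)) η = 0) : η = 0 := by
  have hint := integrable_L2Box η
  have h1 : ∀ B ∈ headSets, ∫ y in B, (η : Lp ℂ 2 gaussianProd) y ∂gaussianProd = 0 := by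
    rintro B ⟨n, hB⟩
    rw [← inner_boxIndicator a (headSigma_le n B hB), h n B hB]
  have h2 : ∫ y, (η : Lp ℂ 2 gaussianProd) y ∂gaussianProd = 0 := by
    rw [← setIntegral_univ]
    exact h1 _ ⟨0, MeasurableSet.univ⟩
  have h3 := hint.ae_eq_zero_of_forall_setIntegral_eq_zero fun s hs _ =>
    setIntegral_eq_zero_of_generateFrom (s := s)
      (C := headSets) (fun t ⟨n, ht⟩ => headSigma_le n t ht) isPiSystem_headSets hint h2 h1
      (by rw [generateFrom_headSets]; exact hs)
  exact Subtype.ext (Lp.eq_zero_iff_ae_eq_zero.mpr h3)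

/-- `A` is the decreasing intersection of its head boxes, so continuity from above identifies its
measure with the infinite product. -/
theorem gaussianProd_boxSet_pos {a : ℕ → ℝ} (ha : a ∈ admissibleSeq) :
    0 < gaussianProd (boxSet a) := by
  obtain ⟨_, L, hL, hlim⟩ := ha
  have h1 : boxSet a = ⋂ n, headBox n a := by
    ext y
    simp only [boxSet, headBox, Set.mem_ofPred_eq, Set.mem_iInter]
    exact ⟨fun h _ i _ => h i, fun h i => h (i + 1) i (Nat.lt_succ_self i)⟩
  have h2 : ∀ n, gaussianProd.real (headBox n a) =
      ∏ i ∈ Finset.range n, (gaussianReal 0 1).real (Set.Ici (a i)) := by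
    intro n
    have h3 : headBox n a = ((Finset.range n : Finset ℕ) : Set ℕ).pi fun i => Set.Ici (a i) := by
      ext y
      simp [headBox, Set.mem_pi]
    rw [h3, Measure.real, gaussianProd, Measure.infinitePi_pi _ fun i _ => measurableSet_Ici,
      ENNReal.toReal_prod]
    rfl
  have h4 : Tendsto (fun n => gaussianProd (headBox n a)) atTop (𝓝 (gaussianProd (boxSet a))) := by
    rw [h1]
    refine tendsto_measure_iInter_atTop
      (fun n => (measurableSet_headBox n a).nullMeasurableSet) ?_ ⟨0, measure_ne_top _ _⟩
    exact fun n n' h y hy i hi => hy i (hi.trans_le h)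
  have h5 := (ENNReal.tendsto_toReal (measure_ne_top gaussianProd (boxSet a))).comp h4
  have h6 := tendsto_nhds_unique (hlim.congr fun n => (h2 n).symm) h5
  exact (ENNReal.toReal_pos_iff.mp (h6 ▸ hL)).1

theorem boxIndicator_univ_ne_zero {a : ℕ → ℝ} (ha : a ∈ admissibleSeq) :
    boxIndicator a MeasurableSet.univ ≠ 0 := by
  intro h
  have h1 : (boxIndicator a MeasurableSet.univ : Lp ℂ 2 gaussianProd) = 0 := by rw [h]; rfl
  refine (gaussianProd_boxSet_pos ha).ne' ?_
  rw [← compl_compl (boxSet a), ← mem_ae_iff]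
  filter_upwards [coeFn_boxIndicator a MeasurableSet.univ, Lp.eq_zero_iff_ae_eq_zero.mp h1]
    with y h2 h3 hy
  rw [h3, Set.indicator_of_mem hy] at h2
  simp at h2

/-! ### The joint eigenvectors of the adjoints -/

/-- The function `∏_{i<n} exp (yᵢ²/4 - yᵢ/2)`. -/
def headTilt (n : ℕ) (y : ℕ → ℝ) : ℝ :=
  Real.exp (∑ i ∈ Finset.range n, (y i ^ 2 / 4 - y i / 2))

theorem headTilt_pos (n : ℕ) (y : ℕ → ℝ) : 0 < headTilt n y := Real.exp_pos _

theorem measurable_headTilt (n : ℕ) : Measurable (headTilt n) := by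
  unfold headTilt
  fun_prop

theorem stronglyMeasurable_headTilt_inv (n : ℕ) :
    StronglyMeasurable[headSigma n] fun y => (headTilt n y)⁻¹ := by
  let _ := headSigma n
  refine Measurable.stronglyMeasurable (Measurable.inv (Real.measurable_exp.comp ?_))
  refine Finset.measurable_fun_sum _ fun i hi => ?_
  have := measurable_eval_headSigma (Finset.mem_range.mp hi)
  exact ((this.pow_const 2).div_const 4).sub (this.div_const 2)

/-- Against the Gaussian density the integrand becomes a multiple of `exp (-z)`, which is integrable
on a half-line bounded below but not on `ℝ`. -/
theorem integrable_indicator_Ici_exp (c : ℝ) :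
    Integrable ((Set.Ici c).indicator fun z => Real.exp (z ^ 2 / 2 - z)) (gaussianReal 0 1) := by
  rw [gaussianReal_of_var_ne_zero _ one_ne_zero,
    integrable_withDensity_iff_integrable_smul' (measurable_gaussianPDF 0 1)
      (ae_of_all _ fun _ => ENNReal.ofReal_lt_top)]
  have h : IntegrableOn (fun z : ℝ => (√(2 * Real.pi * (1 : ℝ≥0)))⁻¹ * Real.exp (-z))
      (Set.Ici c) := by
    rw [integrableOn_Ici_iff_integrableOn_Ioi]
    exact (integrableOn_exp_neg_Ioi c).const_mul _
  rw [← integrable_indicator_iff measurableSet_Ici] at h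
  refine h.congr (ae_of_all _ fun z => ?_)
  by_cases hz : z ∈ Set.Ici c
  · simp only [Set.indicator_of_mem hz, smul_eq_mul, toReal_gaussianPDF, gaussianPDFReal, mul_assoc,
      ← Real.exp_add]
    congr 2
    push_cast
    ring
  · simp [hz]

theorem memLp_indicator_headTilt (a : ℕ → ℝ) (n : ℕ) :
    MemLp ((headBox n a).indicator fun y => (headTilt n y : ℂ)) 2 gaussianProd := by
  have hmeas : AEStronglyMeasurable ((headBox n a).indicator fun y => (headTilt n y : ℂ))
      gaussianProd :=
    ((Complex.measurable_ofReal.comp (measurable_headTilt n)).indicator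
      (measurableSet_headBox n a)).aestronglyMeasurable
  rw [memLp_two_iff_integrable_sq_norm hmeas]
  refine (integrable_prod_gaussianProd (Finset.range n)
    (fun i => (Set.Ici (a i)).indicator fun z => Real.exp (z ^ 2 / 2 - z))
    fun i => integrable_indicator_Ici_exp _).congr (ae_of_all _ fun y => ?_)
  beta_reduce
  by_cases hy : y ∈ headBox n a
  · rw [Set.indicator_of_mem hy, Complex.norm_real, Real.norm_of_nonneg (headTilt_pos n y).le,
      headTilt, ← Real.exp_nat_mul, Finset.mul_sum, Real.exp_sum]
    refine Finset.prod_congr rfl fun i hi => ?_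
    rw [Set.indicator_of_mem (Set.mem_Ici.mpr (hy i (Finset.mem_range.mp hi)))]
    congr 1
    push_cast
    ring
  · rw [Set.indicator_of_notMem hy]
    obtain ⟨i, hi, hyi⟩ : ∃ i < n, ¬ a i ≤ y i := by simpa [headBox] using hy
    simp only [norm_zero, ne_eq, OfNat.ofNat_ne_zero, not_false_eq_true, zero_pow]
    exact Finset.prod_eq_zero (Finset.mem_range.mpr hi) (Set.indicator_of_notMem hyi _)

/-- The restriction to `A` of `∏_{i<n} exp (yᵢ²/4 - yᵢ/2)`, as an element of `L²(A)`. -/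
def headVector (a : ℕ → ℝ) (n : ℕ) : L2Box a := toL2Box a (memLp_indicator_headTilt a n)

theorem coeFn_headVector (a : ℕ → ℝ) (n : ℕ) :
    (headVector a n : Lp ℂ 2 gaussianProd) =ᵐ[gaussianProd]
      (boxSet a).indicator fun y => (headTilt n y : ℂ) := by
  filter_upwards [coeFn_toL2Box a (memLp_indicator_headTilt a n)] with y hy
  rw [headVector, hy]
  by_cases h : y ∈ boxSet a
  · rw [Set.indicator_of_mem h, Set.indicator_of_mem h,
      Set.indicator_of_mem (show y ∈ headBox n a from fun i _ => h i)]
  · rw [Set.indicator_of_notMem h, Set.indicator_of_notMem h]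

/-- The factor `exp (yᵢ²/4)` absorbs the weight of `U_{-x}`, as for an unweighted shift on Lebesgue
space; what remains is `exp (-yᵢ/2)`, which translation multiplies by `exp (-xᵢ/2)`. -/
theorem adjoint_boxRep_headVector (a : ℕ → ℝ) {n : ℕ} (x : RPlusInf)
    (hx : x.1.support ⊆ Finset.range n) :
    ContinuousLinearMap.adjoint (boxRep a x) (headVector a n) =
      ((Real.exp (∑ i ∈ Finset.range n, -(x.1 i / 2)) : ℝ) : ℂ) • headVector a n := by
  refine L2Box_ext ?_
  filter_upwards [coeFn_adjoint_boxRep a x (headVector a n), coeFn_headVector a n,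
    ae_translate x.1 (coeFn_headVector a n),
    Lp.coeFn_smul ((Real.exp (∑ i ∈ Finset.range n, -(x.1 i / 2)) : ℝ) : ℂ)
      (headVector a n : Lp ℂ 2 gaussianProd)] with y h1 h2 h3 h4
  rw [h1, Submodule.coe_smul, h4, Pi.smul_apply, h2]
  by_cases hy : y ∈ boxSet a
  · have hxy : ⇑x.1 + y ∈ boxSet a := fun i => by
      have := x.2 i
      have := hy i
      simp only [Finsupp.coe_zero, Pi.zero_apply, Pi.add_apply] at *
      linarith
    rw [Set.indicator_of_mem hy, Set.indicator_of_mem hy, h3, Set.indicator_of_mem hxy,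
      smul_eq_mul, ← Complex.ofReal_mul, ← Complex.ofReal_mul,
      translateWeight_eq (s := Finset.range n) (by simpa using hx), headTilt, headTilt,
      ← Real.exp_add, ← Real.exp_add, ← Finset.sum_add_distrib, ← Finset.sum_add_distrib]
    congr 2
    refine Finset.sum_congr rfl fun i _ => ?_
    simp only [Finsupp.coe_neg, Pi.neg_apply, Pi.add_apply]
    ring
  · rw [Set.indicator_of_notMem hy, Set.indicator_of_notMem hy, smul_zero]

theorem inner_projection_headVector (a : ℕ → ℝ) (n : ℕ) (x : RPlusInf) (η : L2Box a) :
    inner ℂ (boxRep a x (ContinuousLinearMap.adjoint (boxRep a x) (headVector a n))) η =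
      ∫ y in boxSet (a + x.1), headTilt n y • (η : Lp ℂ 2 gaussianProd) y ∂gaussianProd := by
  rw [inner_L2Box, ← integral_indicator (measurableSet_boxSet _)]
  refine integral_congr_ae ?_
  filter_upwards [coeFn_boxRep_adjoint_boxRep a x (headVector a n), coeFn_headVector a n,
    ae_eq_zero_of_mem_L2Box η] with y h1 h2 h3
  rw [h1]
  by_cases hy : y ∈ boxSet (a + x.1)
  · rw [Set.indicator_of_mem hy, Set.indicator_of_mem hy, h2]
    by_cases hA : y ∈ boxSet a
    · rw [Set.indicator_of_mem hA]
      simp [mul_comm]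
    · simp [h3 hA]
  · rw [Set.indicator_of_notMem hy, Set.indicator_of_notMem hy, inner_zero_left]

/-- Orthogonality to every `P_x g_n` says that `headTilt n • η` integrates to zero over the
generating boxes, hence over the sets of `headSigma n`. As `headTilt n` is measurable for that
σ-algebra, it can be divided out. -/
theorem inner_boxIndicator_eq_zero {a : ℕ → ℝ} {n : ℕ} {η : L2Box a}
    (h : ∀ x : RPlusInf, x.1.support ⊆ Finset.range n →
      inner ℂ (boxRep a x (ContinuousLinearMap.adjoint (boxRep a x) (headVector a n))) η = 0)
    {B : Set (ℕ → ℝ)} (hB : MeasurableSet[headSigma n] B) :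
    inner ℂ (boxIndicator a (headSigma_le n B hB)) η = 0 := by
  let φ : (ℕ → ℝ) → ℂ := fun y => headTilt n y • (η : Lp ℂ 2 gaussianProd) y
  have hint : Integrable φ gaussianProd := by
    refine (L2.integrable_inner (𝕜 := ℂ) (headVector a n : Lp ℂ 2 gaussianProd)
      (η : Lp ℂ 2 gaussianProd)).congr ?_
    filter_upwards [coeFn_headVector a n, ae_eq_zero_of_mem_L2Box η] with y h1 h2
    by_cases hA : y ∈ boxSet a
    · rw [h1, Set.indicator_of_mem hA]
      simp [φ, mul_comm]
    · simp [φ, h2 hA]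
  have hbox : ∀ s : ℕ → ℝ, ∫ y in headBox n s, φ y ∂gaussianProd = 0 := by
    intro s
    -- The positive part of `s - a` on the first `n` coordinates: on `A`, where `η` lives, the box
    -- `headBox n s` agrees with `A + x`.
    let x : RPlusInf := ⟨inclRInf n fun i => max (s i - a i) 0, fun i => by
      rw [inclRInf_apply]
      split_ifs <;> simp⟩
    rw [← h x (support_inclRInf_subset n _), inner_projection_headVector,
      ← integral_indicator (measurableSet_boxSet _),
      ← integral_indicator (measurableSet_headBox n s)]
    refine integral_congr_ae ?_
    filter_upwards [ae_eq_zero_of_mem_L2Box η] with y hy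
    by_cases hA : y ∈ boxSet a
    · have hiff : y ∈ headBox n s ↔ y ∈ boxSet (a + x.1) := by
        refine forall_congr' fun i => ?_
        have hi := hA i
        by_cases hin : i < n
        · simp only [hin, forall_true_left, Pi.add_apply, x, inclRInf_apply, dif_pos]
          rcases max_cases (s i - a i) 0 with ⟨h1, h2⟩ | ⟨h1, h2⟩ <;> rw [h1] <;>
            constructor <;> intro h3 <;> linarith
        · simpa [hin, x, inclRInf_apply] using hi
      by_cases hyB : y ∈ headBox n s
      · rw [Set.indicator_of_mem hyB, Set.indicator_of_mem (hiff.mp hyB)]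
      · rw [Set.indicator_of_notMem hyB, Set.indicator_of_notMem (mt hiff.mpr hyB)]
    · have h0 : φ y = 0 := by simp [φ, hy hA]
      rw [Set.indicator_apply_eq_zero.mpr fun _ => h0]
      exact (Set.indicator_apply_eq_zero.mpr fun _ => h0).symm
  have hzero : ∫ y, φ y ∂gaussianProd = 0 := by
    rw [← hbox a, ← integral_indicator (measurableSet_headBox n a)]
    refine integral_congr_ae ?_
    filter_upwards [ae_eq_zero_of_mem_L2Box η] with y hy
    by_cases hA : y ∈ boxSet a
    · rw [Set.indicator_of_mem (show y ∈ headBox n a from fun i _ => hA i)]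
    · have h0 : φ y = 0 := by simp [φ, hy hA]
      rw [h0, Set.indicator_apply_eq_zero.mpr fun _ => h0]
  have hφ : ∀ s, MeasurableSet[headSigma n] s → ∫ y in s, φ y ∂gaussianProd = 0 := fun s hs =>
    setIntegral_eq_zero_of_generateFrom (by rintro _ ⟨s, rfl⟩; exact measurableSet_headBox n s)
      (isPiSystem_headBox n) hint hzero (by rintro _ ⟨s, rfl⟩; exact hbox s) hs
  have hcancel : ∀ y, (B.indicator fun y => (headTilt n y)⁻¹) y • φ y =
      B.indicator (η : Lp ℂ 2 gaussianProd) y := by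
    intro y
    by_cases hy : y ∈ B
    · rw [Set.indicator_of_mem hy, Set.indicator_of_mem hy, smul_smul,
        inv_mul_cancel₀ (headTilt_pos n y).ne', one_smul]
    · rw [Set.indicator_of_notMem hy, Set.indicator_of_notMem hy, zero_smul]
  rw [inner_boxIndicator, ← integral_indicator (headSigma_le n B hB)]
  simp only [← hcancel]
  refine integral_smul_eq_zero_of_setIntegral_eq_zero (headSigma_le n) hint hφ
    ((stronglyMeasurable_headTilt_inv n).indicator hB) ?_
  exact ((integrable_L2Box η).indicator (headSigma_le n B hB)).congr
    (ae_of_all _ fun y => (hcancel y).symm)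

/-! ### Irreducibility -/

/-- `(A + x) ∩ (A + x') = A + (x ⊔ x')`. -/
theorem projection_mul_projection (a : ℕ → ℝ) (x x' z : RPlusInf) (hz : z.1 = x.1 ⊔ x'.1)
    (f : L2Box a) :
    boxRep a x (ContinuousLinearMap.adjoint (boxRep a x)
      (boxRep a x' (ContinuousLinearMap.adjoint (boxRep a x') f))) =
    boxRep a z (ContinuousLinearMap.adjoint (boxRep a z) f) := by
  refine L2Box_ext ?_
  filter_upwards [coeFn_boxRep_adjoint_boxRep a x
      (boxRep a x' (ContinuousLinearMap.adjoint (boxRep a x') f)),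
    coeFn_boxRep_adjoint_boxRep a x' f, coeFn_boxRep_adjoint_boxRep a z f] with y h1 h2 h3
  have hmem : y ∈ boxSet (a + z.1) ↔ y ∈ boxSet (a + x.1) ∧ y ∈ boxSet (a + x'.1) := by
    simp only [boxSet, Set.mem_ofPred_eq, Pi.add_apply, hz, Finsupp.sup_apply, ← forall_and]
    refine forall_congr' fun i => ?_
    rw [← le_sub_iff_add_le', sup_le_iff, le_sub_iff_add_le', le_sub_iff_add_le']
  rw [h1, h3]
  by_cases hx : y ∈ boxSet (a + x.1) <;> by_cases hx' : y ∈ boxSet (a + x'.1) <;>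
    simp [hx, hx', hmem, h2]

section Commutant

variable {a : ℕ → ℝ} {R : L2Box a →L[ℂ] L2Box a}

/-- Since `R` commutes with `V_x`, the coefficient equals `⟨V_x^* g, R V_x^* g⟩`, a multiple of `⟨g,
R g⟩` by the eigenvector property. -/
theorem inner_headVector_commutant
    (hR : ∀ x f, R (boxRep a x f) = boxRep a x (R f)) {n : ℕ}
    (h0 : inner ℂ (headVector a n) (R (headVector a n)) = 0) (x : RPlusInf)
    (hx : x.1.support ⊆ Finset.range n) :
    inner ℂ (headVector a n)
      (R (boxRep a x (ContinuousLinearMap.adjoint (boxRep a x) (headVector a n)))) = 0 := by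
  rw [hR, ← ContinuousLinearMap.adjoint_inner_left, adjoint_boxRep_headVector a x hx, map_smul,
    inner_smul_left_L2Box, inner_smul_right_L2Box, h0, mul_zero, mul_zero]

theorem inner_projection_commutant
    (hR : ∀ x f, R (boxRep a x f) = boxRep a x (R f))
    (hR' : ∀ x f, R (ContinuousLinearMap.adjoint (boxRep a x) f) =
      ContinuousLinearMap.adjoint (boxRep a x) (R f)) {n : ℕ}
    (h0 : inner ℂ (headVector a n) (R (headVector a n)) = 0) (x x' : RPlusInf)
    (hx : x.1.support ⊆ Finset.range n) (hx' : x'.1.support ⊆ Finset.range n) :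
    inner ℂ (boxRep a x (ContinuousLinearMap.adjoint (boxRep a x) (headVector a n)))
      (R (boxRep a x' (ContinuousLinearMap.adjoint (boxRep a x') (headVector a n)))) = 0 := by
  let z : RPlusInf := ⟨x.1 ⊔ x'.1, x.2.trans le_sup_left⟩
  have hz : z.1.support ⊆ Finset.range n := by
    intro i hi
    by_contra hin
    have h1 : x.1 i = 0 := Finsupp.notMem_support_iff.mp fun h => hin (hx h)
    have h2 : x'.1 i = 0 := Finsupp.notMem_support_iff.mp fun h => hin (hx' h)
    simp [z, h1, h2] at hi
  rw [← ContinuousLinearMap.adjoint_inner_right, ContinuousLinearMap.adjoint_inner_left,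
    ← hR', ← hR,
    projection_mul_projection a x x' z rfl]
  exact inner_headVector_commutant hR h0 z hz

theorem inner_boxIndicator_commutant
    (hR : ∀ x f, R (boxRep a x f) = boxRep a x (R f))
    (hR' : ∀ x f, R (ContinuousLinearMap.adjoint (boxRep a x) f) =
      ContinuousLinearMap.adjoint (boxRep a x) (R f)) {n : ℕ}
    (h0 : inner ℂ (headVector a n) (R (headVector a n)) = 0) {B B' : Set (ℕ → ℝ)}
    (hB : MeasurableSet[headSigma n] B) (hB' : MeasurableSet[headSigma n] B') :
    inner ℂ (boxIndicator a (headSigma_le n B hB))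
      (R (boxIndicator a (headSigma_le n B' hB'))) = 0 := by
  -- The passage from `P_x g_n` to indicators is made in one argument at a time: first with `η = R^*
  -- 1_{A ∩ B}`, then with `η = R P_x g_n`.
  rw [← ContinuousLinearMap.adjoint_inner_left, inner_eq_zero_symm (𝕜 := ℂ)]
  refine inner_boxIndicator_eq_zero (fun x hx => ?_) hB'
  rw [inner_eq_zero_symm (𝕜 := ℂ), ContinuousLinearMap.adjoint_inner_left]
  exact inner_boxIndicator_eq_zero
    (fun x' hx' => inner_projection_commutant hR hR' h0 x' x hx' hx) hB

theorem exists_inner_boxIndicator_sub_smul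
    (hR : ∀ x f, R (boxRep a x f) = boxRep a x (R f))
    (hR' : ∀ x f, R (ContinuousLinearMap.adjoint (boxRep a x) f) =
      ContinuousLinearMap.adjoint (boxRep a x) (R f)) (n : ℕ) :
    ∃ c : ℂ, ∀ (B B' : Set (ℕ → ℝ)) (hB : MeasurableSet[headSigma n] B)
      (hB' : MeasurableSet[headSigma n] B'),
      inner ℂ (boxIndicator a (headSigma_le n B hB))
        (R (boxIndicator a (headSigma_le n B' hB'))) =
      c * inner ℂ (boxIndicator a (headSigma_le n B hB))
        (boxIndicator a (headSigma_le n B' hB')) := by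
  let g := headVector a n
  -- The Rayleigh quotient, chosen so that `⟨g, (R - c) g⟩ = 0`; this also holds trivially if `g =
  -- 0`.
  let c : ℂ := inner ℂ g (R g) / inner ℂ g g
  let S : L2Box a →L[ℂ] L2Box a := R - c • 1
  have hinner : ∀ f f' : L2Box a, inner ℂ f (S f') = inner ℂ f (R f') - c * inner ℂ f f' :=
    fun f f' => by
      change inner ℂ f (R f' - c • f') = _
      rw [inner_sub_right, inner_smul_right_L2Box]
  have hS : ∀ x f, S (boxRep a x f) = boxRep a x (S f) := fun x f => by
    change R _ - c • boxRep a x f = boxRep a x (R f - c • f)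
    rw [hR, map_sub, map_smul]
  have hS' : ∀ x f, S (ContinuousLinearMap.adjoint (boxRep a x) f) =
      ContinuousLinearMap.adjoint (boxRep a x) (S f) := fun x f => by
    change R _ - c • ContinuousLinearMap.adjoint (boxRep a x) f =
      ContinuousLinearMap.adjoint (boxRep a x) (R f - c • f)
    rw [hR', map_sub, map_smul]
  have h0 : inner ℂ g (S g) = 0 := by
    rw [hinner]
    by_cases hg : g = 0
    · rw [hg, inner_zero_left, inner_zero_left, mul_zero, sub_zero]
    · rw [div_mul_cancel₀ _ (inner_self_ne_zero.mpr hg), sub_self]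
  refine ⟨c, fun B B' hB hB' => ?_⟩
  rw [← sub_eq_zero, ← hinner]
  exact inner_boxIndicator_commutant hS hS' h0 hB hB'

theorem exists_eq_smul_one_of_commutant (ha : a ∈ admissibleSeq)
    (hR : ∀ x f, R (boxRep a x f) = boxRep a x (R f))
    (hR' : ∀ x f, R (ContinuousLinearMap.adjoint (boxRep a x) f) =
      ContinuousLinearMap.adjoint (boxRep a x) (R f)) :
    ∃ c : ℂ, c • (1 : L2Box a →L[ℂ] L2Box a) = R := by
  choose c hc using exists_inner_boxIndicator_sub_smul hR hR'
  -- The whole space belongs to every `headSigma n`, and `⟨1_A, 1_A⟩ ≠ 0` can be cancelled.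
  have hconst : ∀ n, c n = c 0 := fun n => by
    have h1 := (hc n _ _ MeasurableSet.univ MeasurableSet.univ).symm.trans
      (hc 0 _ _ MeasurableSet.univ MeasurableSet.univ)
    exact mul_right_cancel₀ (inner_self_ne_zero.mpr (boxIndicator_univ_ne_zero ha)) h1
  let S : L2Box a →L[ℂ] L2Box a := R - c 0 • 1
  have hinner : ∀ f f' : L2Box a, inner ℂ f (S f') = inner ℂ f (R f') - c 0 * inner ℂ f f' :=
    fun f f' => by
      change inner ℂ f (R f' - c 0 • f') = _
      rw [inner_sub_right, inner_smul_right_L2Box]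
  have hS : ∀ (n : ℕ) (B : Set (ℕ → ℝ)) (hB : MeasurableSet[headSigma n] B),
      S (boxIndicator a (headSigma_le n B hB)) = 0 := by
    intro n B hB
    refine eq_zero_of_forall_inner_boxIndicator fun n' B' hB' => ?_
    rw [hinner, sub_eq_zero, ← hconst (max n n')]
    exact hc (max n n') _ _ (headSigma_mono (le_max_right n n') _ hB')
      (headSigma_mono (le_max_left n n') _ hB)
  -- `S` kills every cylinder indicator, so each `S^* f` is orthogonal to a total set.
  have hadj : ContinuousLinearMap.adjoint S = 0 := by
    ext1 f
    refine eq_zero_of_forall_inner_boxIndicator fun n B hB => ?_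
    rw [ContinuousLinearMap.adjoint_inner_right, hS n B hB, inner_zero_left]
  refine ⟨c 0, (sub_eq_zero.mp ?_).symm⟩
  change S = 0
  rw [← ContinuousLinearMap.adjoint_adjoint S, hadj, LinearIsometryEquiv.map_zero]

end Commutant

theorem isIrreducibleRep_boxRep {a : ℕ → ℝ} (ha : a ∈ admissibleSeq) :
    IsIrreducibleRep (boxRep a) := by
  refine ⟨⟨_, _, boxIndicator_univ_ne_zero ha⟩, Set.Subset.antisymm (fun R hR => ?_) ?_⟩
  · rw [Set.mem_centralizer_iff] at hR
    refine exists_eq_smul_one_of_commutant ha (fun x f => ?_) fun x f => ?_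
    · exact (DFunLike.congr_fun (hR _ (Or.inl ⟨x, rfl⟩)) f).symm
    · exact (DFunLike.congr_fun (hR _ (Or.inr ⟨x, rfl⟩)) f).symm
  · rintro _ ⟨c, rfl⟩
    rw [Set.mem_centralizer_iff]
    intro T _
    change T * c • 1 = c • 1 * T
    rw [mul_smul_comm, smul_mul_assoc, mul_one, one_mul]

theorem mainTheorem6 (a : ℕ → ℝ) (ha : a ∈ admissibleSeq) :
    TopologicalSpace.SeparableSpace (L2Box a) ∧ IsIsometricRep (boxRep a) ∧
      IsDoublyCommuting (boxRep a) ∧ IsStronglyPure (boxRep a) ∧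
      IsIrreducibleRep (boxRep a) :=
  ⟨separableSpace_L2Box a, isIsometricRep_boxRep a, isDoublyCommuting_boxRep a,
    isStronglyPure_boxRep a, isIrreducibleRep_boxRep ha⟩

end
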